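/- Let $M$ be a smooth $2$-dimensional manifold. For local coordinates $(u,v)$ on an open set $W\subseteq M$ (a smooth chart), write $\partial_u,\partial_v$ for the coordinate vector fields and $du,dv$ for the coordinate $1$-forms. (a) Let $p\in M$, and let $X$ and $Y$ be smooth vector fields on a neighborhood $U$ of $p$ which are linearly independent at every point of $U$. Then there are local coordinates $(u,v)$ on an open set $W$ with $p\in W\subseteq U$, and smooth positive functions $\lambda,\mu$ on $W$, such that $$\partial_u=\lambda X,\qquad \partial_v=\mu Y\qquad\text{on } W.$$ (b) Let $\langle\cdot,\cdot\rangle$ be a Lorentz metric on $M$, i.e. a smooth field of symmetric nondegenerate bilinear forms of index $1$ on the tangent spaces. Then every $p\in M$ has an open neighborhood $W$ with local coordinates $(u,v)$ on $W$ that are orthogonal: the coefficients $E=\langle\partial_u,\partial_u\rangle$ and $G=\langle\partial_v,\partial_v\rangle$ are smooth on $W$, $F=\langle\partial_u,\partial_v\rangle=0$ and $EG<0$ on $W$, and $$ds^2=E\,du^2+G\,dv^2\qquad\text{on } W.$$ -/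

import Mathlib

open scoped Manifold ContDiff Bundle

noncomputable section

namespace LorentzSurface

/-- The model space `ℝ²` of a `2`-dimensional manifold. -/
abbrev Plane : Type := EuclideanSpace ℝ (Fin 2)

section Coordinates

variable {M : Type*} [TopologicalSpace M] [ChartedSpace Plane M]

/-- The vector field `X` is smooth on `U`, as a section of the tangent bundle. -/
def SmoothFieldOn [IsManifold (𝓡 2) ∞ M] (X : (q : M) → TangentSpace (𝓡 2) q) (U : Set M) : Prop :=
  ContMDiffOn (𝓡 2) (𝓡 2).tangent ∞
    (fun q => (⟨q, X q⟩ : TangentBundle (𝓡 2) M)) U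

/-- The coordinate vector field `∂_i` of the coordinate system `φ` (meaningful on `φ.source`):
the derivative at `φ q` of the parametrization `φ⁻¹` in the direction of the `i`-th standard
basis vector. For a coordinate system `(u, v)`, `∂_u` is `i = 0` and `∂_v` is `i = 1`. -/
def coordField (φ : OpenPartialHomeomorph M Plane) (i : Fin 2) (q : M) : TangentSpace (𝓡 2) q :=
  mfderiv (𝓡 2) (𝓡 2) φ.symm (φ q) (EuclideanSpace.single i (1 : ℝ) : Plane)

/-- The coordinate `1`-form of the coordinate system `φ` (meaningful on `φ.source`): the
differential of the `i`-th coordinate function. For a coordinate system `(u, v)`, `du` is `i = 0`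
and `dv` is `i = 1`. -/
def coordForm (φ : OpenPartialHomeomorph M Plane) (i : Fin 2) (q : M) :
    TangentSpace (𝓡 2) q →L[ℝ] ℝ :=
  mfderiv (𝓡 2) 𝓘(ℝ, ℝ) (fun x => φ x i) q

end Coordinates

/-- A continuous bilinear form `b`, as a (purely algebraic) quadratic form `v ↦ b(v, v)`. -/
def quadForm {V : Type*} [AddCommGroup V] [Module ℝ V] [TopologicalSpace V]
    [IsTopologicalAddGroup V] [ContinuousConstSMul ℝ V] (b : V →L[ℝ] V →L[ℝ] ℝ) :
    QuadraticForm ℝ V :=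
  LinearMap.BilinMap.toQuadraticMap b.toBilinForm

/-- A Lorentz metric on a `2`-dimensional smooth manifold `M` (so that `M` with this metric is a
Lorentz surface): a smooth field of symmetric nondegenerate bilinear forms of index `1` on the
tangent spaces. The index is the maximal dimension of a subspace on which the form is negative
definite. -/
structure LorentzMetric (M : Type*) [TopologicalSpace M] [ChartedSpace Plane M]
    [IsManifold (𝓡 2) ∞ M] where
  inner (q : M) : TangentSpace (𝓡 2) q →L[ℝ] TangentSpace (𝓡 2) q →L[ℝ] ℝ
  symm (q : M) (v w : TangentSpace (𝓡 2) q) : inner q v w = inner q w v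
  nondegenerate (q : M) (v : TangentSpace (𝓡 2) q) : (∀ w, inner q v w = 0) → v = 0
  index_eq_one (q : M) : sigNeg (quadForm (inner q)) = 1
  contMDiff : ContMDiff (𝓡 2) ((𝓡 2).prod 𝓘(ℝ, Plane →L[ℝ] Plane →L[ℝ] ℝ)) ∞
    (fun q => Bundle.TotalSpace.mk' (Plane →L[ℝ] Plane →L[ℝ] ℝ)
      (E := fun q : M => TangentSpace (𝓡 2) q →L[ℝ] TangentSpace (𝓡 2) q →L[ℝ] ℝ) q (inner q))

/-- The coefficients of the metric `g` in the coordinate system `φ = (u, v)`: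
`E` is `metricCoeff g φ 0 0`, `F` is `metricCoeff g φ 0 1` and `G` is `metricCoeff g φ 1 1`. -/
def metricCoeff {M : Type*} [TopologicalSpace M] [ChartedSpace Plane M] [IsManifold (𝓡 2) ∞ M]
    (g : LorentzMetric M) (φ : OpenPartialHomeomorph M Plane) (i j : Fin 2) (q : M) : ℝ :=
  g.inner q (coordField φ i q) (coordField φ j q)

end LorentzSurface

end

/-! For (a), `∂_u` is parallel to `X` and `∂_v` to `Y` exactly when `v` is constant along `X` and
`u` is constant along `Y`. So one looks for first integrals: `v` with `Xv = 0` and `Yv > 0`, and `u`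
with `Yu = 0` and `Xu > 0`. The derivative of `(u, v)` then sends `X` to `(Xu) e₀` and `Y` to `(Yv)
e₁`. It is invertible, and inverting it gives `λ = 1 / Xu`, `μ = 1 / Yv`
(`exists_planar_coordinates`; a chart transfers this to the surface).

A first integral of a nonvanishing planar field (`exists_firstIntegral`) comes from rescaling the
field to `(1, f)`. Its trajectories are graphs of solutions of `dy/dx = f(x, y)`, and the initial
value at `x = 0` of the trajectory through a point is constant along trajectories. Smoothness of
this function follows from smoothness of the flow and the inverse function theorem.

The flow is smooth because the difference of two solutions satisfies a linear scalar equation,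
solved by an explicit exponential. This gives the partial derivative in the initial value, and the
resulting formulas express the derivative of the flow through the flow itself, so regularity
improves one order at a time.

For (b), Gram–Schmidt on a chart-constant frame whose first vector is negative at `p` gives an
orthogonal frame. Part (a) applied to it preserves orthogonality, since the coordinate fields are
multiples of the frame. Nondegeneracy and index one force `EG < 0`. -/

namespace LorentzSurface

open MeasureTheory Set Filter Topology

/-! ### Smoothness of integrals depending on a parameter. -/

section ParametricIntegral

variable {E F : Type*} [NormedAddCommGroup E] [NormedSpace ℝ E]
  [NormedAddCommGroup F] [NormedSpace ℝ F]

/-- Integrating a `C^n` function of two variables over the unit interval in the second variable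
gives a `C^n` function of the first variable. -/
theorem contDiff_integral_unitInterval {n : ℕ∞} {k : E × ℝ → F} (hk : ContDiff ℝ n k) :
    ContDiff ℝ n (fun z : E => ∫ t in (0 : ℝ)..1, k (z, t)) := by
  -- The integral is the convolution at `0` of the indicator of `(0, 1]` with `s ↦ χ s • k (z, -s)`.
  -- The cutoff supplies compact support and equals `1` on `[-1, 1]`, so it does not change the
  -- value.
  let χ : ContDiffBump (0 : ℝ) := ⟨1, 2, one_pos, one_lt_two⟩
  have h := contDiffOn_convolution_right_with_param (𝕜 := ℝ) (μ := (volume : Measure ℝ))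
    (f := indicator (Ioc (0 : ℝ) 1) (fun _ => (1 : ℝ))) (n := n)
    (ContinuousLinearMap.lsmul ℝ ℝ) (g := fun (z : E) (s : ℝ) => χ s • k (z, -s))
    (s := univ) (k := Metric.closedBall (0 : ℝ) 2) isOpen_univ (isCompact_closedBall _ _)
    (fun z s _ hs => by
      have : χ s = 0 := χ.zero_of_le_dist (by
        simp only [Metric.mem_closedBall, not_le] at hs; exact hs.le)
      simp [this])
    (((integrable_indicator_iff measurableSet_Ioc).2 (by
      simp)).locallyIntegrable)
    (by
      refine ContDiff.contDiffOn ?_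
      exact (χ.contDiff.comp contDiff_snd).smul
        (hk.comp (contDiff_fst.prodMk contDiff_snd.neg)))
  rw [univ_prod_univ, contDiffOn_univ] at h
  have h2 := h.comp (contDiff_id.prodMk (contDiff_const (c := (0 : ℝ))) : ContDiff ℝ n
    (fun z : E => (z, (0 : ℝ))))
  convert h2 using 1
  funext z
  simp only [Function.comp_apply, id, convolution, zero_sub, neg_neg,
    ContinuousLinearMap.lsmul_apply]
  rw [intervalIntegral.integral_of_le zero_le_one, ← integral_indicator measurableSet_Ioc]
  refine integral_congr_ae (Eventually.of_forall fun t => ?_)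
  by_cases ht : t ∈ Ioc (0 : ℝ) 1
  · have : χ (-t) = 1 := χ.one_of_mem_closedBall (by
      simp only [Metric.mem_closedBall, dist_zero_right, norm_neg, Real.norm_eq_abs]
      rw [abs_of_pos ht.1]; exact ht.2)
    simp [ht, this]
  · simp [ht]

/-- The primitive in the first variable of a `C^n` function on the plane is `C^n`. -/
theorem contDiff_primitive_fst {n : ℕ∞} {h : ℝ × ℝ → ℝ} (hh : ContDiff ℝ n h) :
    ContDiff ℝ n (fun z : ℝ × ℝ => ∫ s in (0 : ℝ)..z.1, h (s, z.2)) := by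
  -- The substitution `s = z.1 * t` moves the variable endpoint into the integrand.
  have h1 : ContDiff ℝ n (fun z : ℝ × ℝ => z.1 * ∫ t in (0 : ℝ)..1, h (z.1 * t, z.2)) := by
    refine contDiff_fst.mul (contDiff_integral_unitInterval
      (k := fun w : (ℝ × ℝ) × ℝ => h (w.1.1 * w.2, w.1.2)) ?_)
    exact hh.comp (((contDiff_fst.comp contDiff_fst).mul contDiff_snd).prodMk
      (contDiff_snd.comp contDiff_fst))
  convert h1 using 2 with z
  have := intervalIntegral.smul_integral_comp_mul_left (fun s => h (s, z.2)) z.1 (a := 0) (b := 1)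
  simpa using this.symm

end ParametricIntegral

/-! ### Scalar ODEs: global solutions and smooth dependence on initial values. -/

section ScalarODE

/-- The solution of a homogeneous linear scalar ODE with continuous coefficient. -/
theorem eq_mul_exp_of_hasDerivAt_mul {c d : ℝ → ℝ} (hc : Continuous c)
    (hd : ∀ x, HasDerivAt d (c x * d x) x) (x : ℝ) :
    d x = d 0 * Real.exp (∫ s in (0 : ℝ)..x, c s) := by
  have hI : ∀ x, HasDerivAt (fun x => ∫ s in (0 : ℝ)..x, c s) (c x) x := fun x =>
    intervalIntegral.integral_hasDerivAt_right (hc.intervalIntegrable _ _)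
      hc.stronglyMeasurable.stronglyMeasurableAtFilter hc.continuousAt
  have h0 : ∀ x, HasDerivAt (fun x => d x * Real.exp (-∫ s in (0 : ℝ)..x, c s)) 0 x := fun x => by
    refine ((hd x).mul (hI x).neg.exp).congr_deriv ?_
    ring
  have h1 := is_const_of_deriv_eq_zero (fun x => (h0 x).differentiableAt)
    (fun x => (h0 x).deriv) x 0
  simp only [intervalIntegral.integral_same, neg_zero, Real.exp_zero, mul_one] at h1
  rw [← h1, mul_assoc, ← Real.exp_add]
  simp

/-- The partial derivative in the second variable. -/
noncomputable def sndDeriv (f : ℝ × ℝ → ℝ) (p : ℝ × ℝ) : ℝ := fderiv ℝ f p (0, 1)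

/-- The averaged slope of `f (x, ·)` between `a` and `b`. -/
noncomputable def secantSlope (f : ℝ × ℝ → ℝ) (x a b : ℝ) : ℝ :=
  ∫ t in (0 : ℝ)..1, sndDeriv f (x, a + t * (b - a))

variable {f : ℝ × ℝ → ℝ}

theorem contDiff_sndDeriv (hf : ContDiff ℝ ∞ f) : ContDiff ℝ ∞ (sndDeriv f) :=
  (hf.fderiv_right (m := ∞) le_rfl).clm_apply contDiff_const

theorem hasDerivAt_snd (hf : ContDiff ℝ ∞ f) (x y : ℝ) :
    HasDerivAt (fun y => f (x, y)) (sndDeriv f (x, y)) y := by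
  have h1 : HasFDerivAt f (fderiv ℝ f (x, y)) (x, y) :=
    ((hf.differentiable (by simp)) (x, y)).hasFDerivAt
  exact h1.comp_hasDerivAt y ((hasDerivAt_const y x).prodMk (hasDerivAt_id y))

/-- Hadamard's lemma: integrate the derivative along the segment from `a` to `b`. Unlike the
difference quotient, the averaged slope stays continuous across `a = b`. -/
theorem sub_eq_secantSlope_mul (hf : ContDiff ℝ ∞ f) (x a b : ℝ) :
    f (x, b) - f (x, a) = secantSlope f x a b * (b - a) := by
  have hc := (contDiff_sndDeriv hf).continuous
  have h1 : ∀ t ∈ uIcc (0 : ℝ) 1, HasDerivAt (fun t => f (x, a + t * (b - a)))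
      (sndDeriv f (x, a + t * (b - a)) * (b - a)) t := fun t _ => by
    have h2 : HasDerivAt (fun t => a + t * (b - a)) (b - a) t := by
      simpa using ((hasDerivAt_id t).mul_const (b - a)).const_add a
    exact (hasDerivAt_snd hf x (a + t * (b - a))).comp t h2
  have h3 := intervalIntegral.integral_eq_sub_of_hasDerivAt h1
    (Continuous.intervalIntegrable (by fun_prop) _ _)
  rw [intervalIntegral.integral_mul_const] at h3
  rw [secantSlope, h3]
  simp

theorem secantSlope_self (x a : ℝ) : secantSlope f x a a = sndDeriv f (x, a) := by
  simp [secantSlope]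

theorem continuous_secantSlope (hf : ContDiff ℝ ∞ f) :
    Continuous (fun p : ℝ × ℝ × ℝ => secantSlope f p.1 p.2.1 p.2.2) := by
  have hc := (contDiff_sndDeriv hf).continuous
  unfold secantSlope
  refine intervalIntegral.continuous_parametric_intervalIntegral_of_continuous' ?_ _ _
  simp only [Function.uncurry_def]
  fun_prop

theorem abs_secantSlope_le {K : ℝ} (hK : ∀ p, |sndDeriv f p| ≤ K) (x a b : ℝ) :
    |secantSlope f x a b| ≤ K := by
  have := intervalIntegral.norm_integral_le_of_norm_le_const (a := 0) (b := 1) (C := K)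
    (f := fun t => sndDeriv f (x, a + t * (b - a))) (fun t _ => hK _)
  simpa [secantSlope] using this

/-- A smooth bounded scalar ODE with bounded partial derivative has global solutions. -/
theorem exists_global_solution (hf : ContDiff ℝ ∞ f) {K L : ℝ}
    (hK : ∀ p, |sndDeriv f p| ≤ K) (hL : ∀ p, |f p| ≤ L) (y : ℝ) :
    ∃ γ : ℝ → ℝ, γ 0 = y ∧ ∀ x, HasDerivAt γ (f (x, γ x)) x := by
  have hK0 : 0 ≤ K := (abs_nonneg _).trans (hK 0)
  have hL0 : 0 ≤ L := (abs_nonneg _).trans (hL 0)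
  have hlip : ∀ x, LipschitzWith K.toNNReal (fun y => f (x, y)) := fun x =>
    LipschitzWith.of_dist_le_mul fun a b => by
      rw [Real.dist_eq, Real.dist_eq, sub_eq_secantSlope_mul hf, abs_mul, Real.coe_toNNReal _ hK0]
      exact mul_le_mul_of_nonneg_right (abs_secantSlope_le hK _ _ _) (abs_nonneg _)
  have hloc : ∀ T : ℝ, 0 < T → ∃ γ : ℝ → ℝ, γ 0 = y ∧
      ∀ x ∈ Ioo (-T) T, HasDerivAt γ (f (x, γ x)) x := fun T hT => by
    -- Since `|f| ≤ L` everywhere, a solution moves at most `L * T` in time `T`; a ball of that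
    -- radius works for every `T`.
    have hpl : IsPicardLindelof (fun x y => f (x, y)) (tmin := -T) (tmax := T)
        ⟨0, by simp [hT.le]⟩ y (L * T).toNNReal 0 L.toNNReal K.toNNReal :=
      { lipschitzOnWith := fun x _ => (hlip x).lipschitzOnWith
        continuousOn := fun y _ => by
          have := hf.continuous
          fun_prop
        norm_le := fun x _ y _ => by
          rw [Real.norm_eq_abs, Real.coe_toNNReal _ hL0]; exact hL _
        mul_max_le := by
          rw [Real.coe_toNNReal _ hL0, Real.coe_toNNReal _ (by positivity)]
          simp }
    obtain ⟨γ, h0, h⟩ := hpl.exists_eq_forall_mem_Icc_hasDerivWithinAt₀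
    exact ⟨γ, h0, fun x hx => (h x (Ioo_subset_Icc_self hx)).hasDerivAt (Icc_mem_nhds hx.1 hx.2)⟩
  choose! γ h0 h using hloc
  -- By uniqueness the local solutions agree, so they glue by evaluating at `x` the one with `T =
  -- |x| + 1`.
  have heq : ∀ T, 0 < T → ∀ x ∈ Ioo (-T) T, γ (|x| + 1) x = γ T x := fun T hT x hx => by
    have hS : 0 < |x| + 1 := by positivity
    have hM : 0 < min (|x| + 1) T := lt_min hS hT
    have hx' : x ∈ Ioo (-min (|x| + 1) T) (min (|x| + 1) T) := by
      rw [mem_Ioo, ← abs_lt] at hx ⊢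
      exact lt_min (lt_add_one _) hx
    refine ODE_solution_unique_of_mem_Ioo (v := fun x y => f (x, y)) (s := fun _ => univ)
      (t₀ := 0) (fun t _ => (hlip t).lipschitzOnWith) (by simpa using hM)
      (fun t ht => ⟨h _ hS t ?_, mem_univ _⟩) (fun t ht => ⟨h _ hT t ?_, mem_univ _⟩)
      ((h0 _ hS).trans (h0 _ hT).symm) hx' <;>
    rw [mem_Ioo, ← abs_lt] at ht ⊢
    · exact ht.trans_le (min_le_left _ _)
    · exact ht.trans_le (min_le_right _ _)
  refine ⟨fun x => γ (|x| + 1) x, h0 _ (by positivity), fun x => ?_⟩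
  have hS : 0 < |x| + 1 := by positivity
  have hx : x ∈ Ioo (-(|x| + 1)) (|x| + 1) := by
    rw [mem_Ioo, ← abs_lt]; exact lt_add_one _
  refine (h _ hS x hx).congr_of_eventuallyEq ?_
  filter_upwards [Ioo_mem_nhds hx.1 hx.2] with z hz
  exact heq _ hS z hz

/-- `φ` is the flow of the scalar ODE `dy/dx = f (x, y)`, started at `x = 0`. -/
structure IsScalarFlow (f : ℝ × ℝ → ℝ) (φ : ℝ → ℝ → ℝ) : Prop where
  zero_left : ∀ y, φ 0 y = y
  hasDerivAt : ∀ x y, HasDerivAt (fun x => φ x y) (f (x, φ x y)) x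

namespace IsScalarFlow

variable {φ : ℝ → ℝ → ℝ} (h : IsScalarFlow f φ)

include h

theorem continuous_left (y : ℝ) : Continuous (fun x => φ x y) :=
  continuous_iff_continuousAt.2 fun x => (h.hasDerivAt x y).continuousAt

/-- The difference of two trajectories satisfies `d' = c d`, with `c` the secant slope of `f`
between them. -/
theorem sub_eq (hf : ContDiff ℝ ∞ f) (x y z : ℝ) :
    φ x z - φ x y =
      (z - y) * Real.exp (∫ s in (0 : ℝ)..x, secantSlope f s (φ s y) (φ s z)) := by
  have hc : Continuous fun s => secantSlope f s (φ s y) (φ s z) :=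
    (continuous_secantSlope hf).comp
      (continuous_id.prodMk ((h.continuous_left y).prodMk (h.continuous_left z)))
  have := eq_mul_exp_of_hasDerivAt_mul (d := fun x => φ x z - φ x y) hc (fun s => by
    refine ((h.hasDerivAt s z).sub (h.hasDerivAt s y)).congr_deriv ?_
    rw [sub_eq_secantSlope_mul hf]) x
  simpa [h.zero_left] using this

/-- `sub_eq` gives a Lipschitz bound `exp (K |x|)` in the initial value, and `|f| ≤ L` gives one in
time. -/
theorem continuous (hf : ContDiff ℝ ∞ f) {K L : ℝ}
    (hK : ∀ p, |sndDeriv f p| ≤ K) (hL : ∀ p, |f p| ≤ L) :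
    Continuous (fun p : ℝ × ℝ => φ p.1 p.2) := by
  have hy : ∀ x y z, |φ x z - φ x y| ≤ |z - y| * Real.exp (K * |x|) := fun x y z => by
    rw [h.sub_eq hf, abs_mul, Real.abs_exp]
    refine mul_le_mul_of_nonneg_left (Real.exp_le_exp.2 ((le_abs_self _).trans ?_)) (abs_nonneg _)
    have := intervalIntegral.norm_integral_le_of_norm_le_const (a := 0) (b := x) (C := K)
      (f := fun s => secantSlope f s (φ s y) (φ s z)) (fun t _ => abs_secantSlope_le hK _ _ _)
    simpa using this
  have hx : ∀ x w y, |φ w y - φ x y| ≤ L * |w - x| := fun x w y => by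
    have := convex_univ.norm_image_sub_le_of_norm_hasDerivWithin_le (f := fun x => φ x y)
      (fun s _ => (h.hasDerivAt s y).hasDerivWithinAt) (fun s _ => hL _) (mem_univ x) (mem_univ w)
    simpa using this
  rw [continuous_iff_continuousAt]
  rintro ⟨x, y⟩
  rw [ContinuousAt, tendsto_iff_dist_tendsto_zero]
  have hb : Tendsto (fun p : ℝ × ℝ => |p.2 - y| * Real.exp (K * |p.1|) + L * |p.1 - x|)
      (𝓝 (x, y)) (𝓝 0) := by
    have : Continuous (fun p : ℝ × ℝ => |p.2 - y| * Real.exp (K * |p.1|) + L * |p.1 - x|) := by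
      fun_prop
    simpa using this.tendsto (x, y)
  refine squeeze_zero (fun _ => dist_nonneg) (fun p => ?_) hb
  refine (dist_triangle _ (φ p.1 y) _).trans ?_
  exact add_le_add (hy _ _ _) (hx _ _ _)

/-- By `sub_eq` the difference quotient is exactly an exponential that is continuous in `z`,
including at `z = y`, where the secant slope becomes the partial derivative. -/
theorem hasDerivAt_right (hf : ContDiff ℝ ∞ f) (hφ : Continuous (fun p : ℝ × ℝ => φ p.1 p.2))
    (x y : ℝ) :
    HasDerivAt (fun y => φ x y)
      (Real.exp (∫ s in (0 : ℝ)..x, sndDeriv f (s, φ s y))) y := by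
  have hc : Continuous fun z =>
      Real.exp (∫ s in (0 : ℝ)..x, secantSlope f s (φ s y) (φ s z)) := by
    refine Real.continuous_exp.comp
      (intervalIntegral.continuous_parametric_intervalIntegral_of_continuous' ?_ _ _)
    exact (continuous_secantSlope hf).comp (continuous_snd.prodMk
      (((h.continuous_left y).comp continuous_snd).prodMk
        (hφ.comp (continuous_snd.prodMk continuous_fst))))
  rw [hasDerivAt_iff_tendsto_slope]
  have h1 := hc.tendsto y
  simp only [secantSlope_self] at h1
  refine (h1.mono_left nhdsWithin_le_nhds).congr' ?_
  filter_upwards [self_mem_nhdsWithin] with z hz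
  have hz' : z - y ≠ 0 := sub_ne_zero.2 hz
  rw [slope_def_field, h.sub_eq hf]
  field_simp

/-- Both partial derivatives exist and are continuous. -/
theorem hasFDerivAt (hf : ContDiff ℝ ∞ f) (hφ : Continuous (fun p : ℝ × ℝ => φ p.1 p.2))
    (p : ℝ × ℝ) :
    HasFDerivAt (fun p : ℝ × ℝ => φ p.1 p.2)
      (f (p.1, φ p.1 p.2) • ContinuousLinearMap.fst ℝ ℝ ℝ +
        Real.exp (∫ s in (0 : ℝ)..p.1, sndDeriv f (s, φ s p.2)) •
          ContinuousLinearMap.snd ℝ ℝ ℝ) p := by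
  have hs := (contDiff_sndDeriv hf).continuous
  have hfc := hf.continuous
  have hJ : Continuous fun p : ℝ × ℝ =>
      Real.exp (∫ s in (0 : ℝ)..p.1, sndDeriv f (s, φ s p.2)) := by
    refine Real.continuous_exp.comp
      (intervalIntegral.continuous_parametric_intervalIntegral_of_continuous ?_ continuous_fst)
    exact hs.comp (continuous_snd.prodMk
      (hφ.comp (continuous_snd.prodMk (continuous_snd.comp continuous_fst))))
  have := (hasStrictFDerivAt_uncurry_coprod (f := φ) (u := p)
    (f₁ := fun x y => ContinuousLinearMap.toSpanSingleton ℝ (f (x, φ x y)))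
    (f₂ := fun x y => ContinuousLinearMap.toSpanSingleton ℝ
      (Real.exp (∫ s in (0 : ℝ)..x, sndDeriv f (s, φ s y))))
    (Eventually.of_forall fun v => (h.hasDerivAt v.1 v.2).hasFDerivAt)
    (Eventually.of_forall fun v => (h.hasDerivAt_right hf hφ v.1 v.2).hasFDerivAt)
    (by
      refine Continuous.continuousAt ?_
      exact (ContinuousLinearMap.toSpanSingletonCLE (𝕜 := ℝ) (E := ℝ)).continuous.comp
        (hfc.comp (continuous_fst.prodMk hφ)))
    (by
      refine Continuous.continuousAt ?_
      exact (ContinuousLinearMap.toSpanSingletonCLE (𝕜 := ℝ) (E := ℝ)).continuous.comp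
        hJ)).hasFDerivAt
  refine this.congr_fderiv ?_
  ext <;> simp [Function.HasUncurry.uncurry]

/-- The flow of a smooth scalar ODE is smooth. -/
theorem contDiff (hf : ContDiff ℝ ∞ f) (hφ : Continuous (fun p : ℝ × ℝ => φ p.1 p.2)) :
    ContDiff ℝ ∞ (fun p : ℝ × ℝ => φ p.1 p.2) := by
  rw [contDiff_infty]
  intro n
  induction n with
  | zero => exact contDiff_zero.2 hφ
  | succ n ih =>
    have ih' : ContDiff ℝ (n : ℕ∞) (fun p : ℝ × ℝ => φ p.1 p.2) := ih
    have hn : ((n : ℕ∞) : WithTop ℕ∞) ≤ ∞ := by exact_mod_cast le_top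
    push_cast
    rw [contDiff_succ_iff_hasFDerivAt]
    -- Bootstrap: both coefficients of the derivative are built from `φ`, smooth functions and a
    -- primitive in `x`, so they are as regular as `φ`.
    refine ⟨_, ?_, h.hasFDerivAt hf hφ⟩
    refine ContDiff.add (ContDiff.fun_smul ?_ contDiff_const) (ContDiff.fun_smul ?_ contDiff_const)
    · exact (hf.of_le hn).comp (contDiff_fst.prodMk ih')
    · exact (contDiff_primitive_fst (h := fun p => sndDeriv f (p.1, φ p.1 p.2))
        (((contDiff_sndDeriv hf).of_le hn).comp (contDiff_fst.prodMk ih'))).exp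

end IsScalarFlow

/-- The smooth flow of a compactly supported scalar ODE. -/
theorem exists_contDiff_scalarFlow (hf : ContDiff ℝ ∞ f) (hs : HasCompactSupport f) :
    ∃ φ : ℝ → ℝ → ℝ, IsScalarFlow f φ ∧ ContDiff ℝ ∞ (fun p : ℝ × ℝ => φ p.1 p.2) := by
  obtain ⟨L, hL⟩ := hf.continuous.bounded_above_of_compact_support hs
  have hs' : HasCompactSupport (sndDeriv f) :=
    (hs.fderiv ℝ).comp_left (g := fun A : ℝ × ℝ →L[ℝ] ℝ => A (0, 1)) rfl
  obtain ⟨K, hK⟩ := (contDiff_sndDeriv hf).continuous.bounded_above_of_compact_support hs'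
  choose γ h0 h using exists_global_solution hf hK hL
  have hfl : IsScalarFlow f (fun x y => γ y x) := ⟨h0, fun x y => h y x⟩
  exact ⟨_, hfl, hfl.contDiff hf (hfl.continuous hf hK hL)⟩

end ScalarODE

/-! ### First integrals and adapted coordinates in the plane. -/

section Planar

/-- The inverse function theorem, as a smooth local diffeomorphism. -/
theorem exists_openPartialHomeomorph_of_contDiffOn {E F : Type*} [NormedAddCommGroup E]
    [NormedSpace ℝ E] [CompleteSpace E] [NormedAddCommGroup F] [NormedSpace ℝ F]
    {f : E → F} {U : Set E} (hU : IsOpen U) (hf : ContDiffOn ℝ ∞ f U) {x : E} (hx : x ∈ U)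
    (e : E ≃L[ℝ] F) (he : HasFDerivAt f (e : E →L[ℝ] F) x) :
    ∃ φ : OpenPartialHomeomorph E F, x ∈ φ.source ∧ φ.source ⊆ U ∧ (φ : E → F) = f ∧
      ContDiffOn ℝ ∞ φ φ.source ∧ ContDiffOn ℝ ∞ φ.symm φ.target := by
  have hfx : ∀ y ∈ U, ContDiffAt ℝ ∞ f y := fun y hy => hf.contDiffAt (hU.mem_nhds hy)
  let φ₀ := (hfx x hx).toOpenPartialHomeomorph f he (by simp)
  -- Invertibility is an open condition; shrinking to where the derivative is invertible makes the
  -- inverse smooth on all of its domain.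
  have hnhds : ∀ᶠ y in 𝓝 x, y ∈ U ∧ fderiv ℝ f y ∈ range ((↑) : (E ≃L[ℝ] F) → E →L[ℝ] F) := by
    have hxU : ∀ᶠ y in 𝓝 x, y ∈ U := hU.mem_nhds hx
    refine hxU.and ?_
    have hc : ContinuousAt (fderiv ℝ f) x :=
      ((hfx x hx).fderiv_right (m := 0) (by simp)).continuousAt
    exact hc.eventually (by rw [he.fderiv]; exact ContinuousLinearEquiv.nhds e)
  obtain ⟨V, hV, hVo, hxV⟩ := eventually_nhds_iff.1 hnhds
  let φ := φ₀.restrOpen V hVo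
  refine ⟨φ, ⟨(hfx x hx).mem_toOpenPartialHomeomorph_source he (by simp), hxV⟩,
    fun y hy => (hV y hy.2).1, rfl, hf.mono fun y hy => (hV y hy.2).1, fun z hz => ?_⟩
  obtain ⟨hU', e', he'⟩ := hV (φ.symm z) (φ.map_target hz).2
  refine (φ.contDiffAt_symm hz (f₀' := e') ?_ (hfx _ hU')).contDiffWithinAt
  rw [he']
  exact ((hfx _ hU').differentiableAt (by simp)).hasFDerivAt

/-- The shear `(a, b) ↦ (a, c a + b)`. -/
noncomputable def shear (c : ℝ) : (ℝ × ℝ) ≃L[ℝ] (ℝ × ℝ) :=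
  ContinuousLinearEquiv.equivOfInverse
    ((ContinuousLinearMap.fst ℝ ℝ ℝ).prod
      (c • ContinuousLinearMap.fst ℝ ℝ ℝ + ContinuousLinearMap.snd ℝ ℝ ℝ))
    ((ContinuousLinearMap.fst ℝ ℝ ℝ).prod
      (-c • ContinuousLinearMap.fst ℝ ℝ ℝ + ContinuousLinearMap.snd ℝ ℝ ℝ))
    (fun p => by ext <;> simp) (fun p => by ext <;> simp)

/-- A function smooth near a point agrees near it with a compactly supported smooth function. -/
theorem exists_contDiff_compactSupport_eqOn {E : Type*} [NormedAddCommGroup E] [NormedSpace ℝ E]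
    [FiniteDimensional ℝ E] {f : E → ℝ} {U : Set E} (hU : IsOpen U)
    (hf : ContDiffOn ℝ ∞ f U) {x : E} (hx : x ∈ U) :
    ∃ (g : E → ℝ) (W : Set E), ContDiff ℝ ∞ g ∧ HasCompactSupport g ∧ IsOpen W ∧ x ∈ W ∧ W ⊆ U ∧
      EqOn g f W := by
  obtain ⟨r, hr, hrU⟩ := Metric.isOpen_iff.1 hU x hx
  let χ : ContDiffBump x := ⟨r / 4, r / 2, by positivity, by linarith⟩
  have hχU : tsupport χ ⊆ U := by
    rw [χ.tsupport_eq]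
    exact (Metric.closedBall_subset_ball (by simp only [χ]; linarith)).trans hrU
  refine ⟨fun y => χ y * f y, Metric.ball x (r / 4), contDiff_iff_contDiffAt.2 fun y => ?_,
    χ.hasCompactSupport.mul_right, Metric.isOpen_ball, Metric.mem_ball_self (by positivity),
    (Metric.ball_subset_ball (by linarith)).trans hrU, fun y hy => ?_⟩
  · by_cases hy : y ∈ U
    · exact χ.contDiffAt.mul (hf.contDiffAt (hU.mem_nhds hy))
    · have : y ∉ tsupport χ := fun h => hy (hχU h)
      refine contDiffAt_const (c := (0 : ℝ)).congr_of_eventuallyEq ?_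
      filter_upwards [notMem_tsupport_iff_eventuallyEq.1 this] with z hz
      simp [hz]
  · simp [χ.one_of_mem_closedBall (Metric.ball_subset_closedBall hy)]

/-- Local existence of a first integral of the field `(1, f)`. -/
theorem exists_firstIntegral_graph {f : ℝ × ℝ → ℝ} {U : Set (ℝ × ℝ)} (hU : IsOpen U)
    (hf : ContDiffOn ℝ ∞ f U) (h0 : (0 : ℝ × ℝ) ∈ U) :
    ∃ (v : ℝ × ℝ → ℝ) (W : Set (ℝ × ℝ)), IsOpen W ∧ (0 : ℝ × ℝ) ∈ W ∧ W ⊆ U ∧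
      ContDiffOn ℝ ∞ v W ∧ fderiv ℝ v 0 ≠ 0 ∧ ∀ p ∈ W, fderiv ℝ v p (1, f p) = 0 := by
  obtain ⟨g, W, hg, hgs, hW, h0W, hWU, hgf⟩ := exists_contDiff_compactSupport_eqOn hU hf h0
  obtain ⟨φ, hφ, hφs⟩ := exists_contDiff_scalarFlow hg hgs
  -- `Φ` carries horizontal lines to trajectories, so the second component of its inverse is the
  -- first integral. At the origin the flow has unit derivative in `y`, which makes the derivative
  -- of `Φ` a shear.
  let Φ : ℝ × ℝ → ℝ × ℝ := fun p => (p.1, φ p.1 p.2)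
  have hΦ : ContDiff ℝ ∞ Φ := contDiff_fst.prodMk hφs
  have hΦ0 : Φ 0 = 0 := by simp [Φ, hφ.zero_left]
  have hD : HasFDerivAt Φ (shear (g 0) : (ℝ × ℝ) →L[ℝ] ℝ × ℝ) 0 := by
    refine (hasFDerivAt_fst.prodMk (hφ.hasFDerivAt hg hφs.continuous 0)).congr_fderiv ?_
    ext <;> simp [shear, hφ.zero_left, Prod.mk_zero_zero]
  obtain ⟨e, h0e, -, heΦ, -, hes⟩ :=
    exists_openPartialHomeomorph_of_contDiffOn isOpen_univ hΦ.contDiffOn (mem_univ _) _ hD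
  have h0t : (0 : ℝ × ℝ) ∈ e.target := by
    have := e.map_source h0e
    rwa [heΦ, hΦ0] at this
  let v : ℝ × ℝ → ℝ := fun p => (e.symm p).2
  have hv : ContDiffOn ℝ ∞ v e.target := contDiff_snd.comp_contDiffOn hes
  have hvd : ∀ p ∈ e.target, HasFDerivAt v (fderiv ℝ v p) p := fun p hp =>
    ((hv.contDiffAt (e.open_target.mem_nhds hp)).differentiableAt (by simp)).hasFDerivAt
  have hvΦ : ∀ p ∈ e.source, v (Φ p) = p.2 := fun p hp => by
    simp only [v, ← heΦ, e.left_inv hp]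
  have hchain : ∀ p ∈ e.source, (fderiv ℝ v (Φ p)).comp (fderiv ℝ Φ p) =
      ContinuousLinearMap.snd ℝ ℝ ℝ := fun p hp => by
    have h1 : HasFDerivAt (v ∘ Φ) ((fderiv ℝ v (Φ p)).comp (fderiv ℝ Φ p)) p :=
      (hvd _ (by rw [← heΦ]; exact e.map_source hp)).comp p
        ((hΦ.differentiable (by simp)) p).hasFDerivAt
    refine h1.unique (hasFDerivAt_snd.congr_of_eventuallyEq ?_)
    filter_upwards [e.open_source.mem_nhds hp] with q hq using hvΦ q hq
  refine ⟨v, e.target ∩ W, e.open_target.inter hW, ⟨h0t, h0W⟩, fun p hp => hWU hp.2,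
    hv.mono inter_subset_left, fun h => ?_, fun p hp => ?_⟩
  · have := DFunLike.congr_fun (hchain 0 h0e) (0, 1)
    rw [hΦ0, h] at this
    simp at this
  · have hq := e.map_target hp.1
    have hpΦ : Φ (e.symm p) = p := by rw [← heΦ, e.right_inv hp.1]
    have h2 := DFunLike.congr_fun (hchain _ hq) (1, 0)
    have h3 : fderiv ℝ Φ (e.symm p) (1, 0) = (1, g p) := by
      have h4 : HasFDerivAt Φ _ (e.symm p) :=
        hasFDerivAt_fst.prodMk (hφ.hasFDerivAt hg hφs.continuous (e.symm p))
      rw [h4.fderiv]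
      ext
      · simp
      · have : g ((e.symm p).1, φ (e.symm p).1 (e.symm p).2) = g p := congrArg g hpΦ
        simp [this]
    rw [ContinuousLinearMap.comp_apply, h3, hpΦ, hgf hp.2] at h2
    simpa using h2

/-- Local existence of a first integral of a nonvanishing smooth planar field. -/
theorem exists_firstIntegral {X : Plane → Plane} {U : Set Plane} (hU : IsOpen U)
    (hX : ContDiffOn ℝ ∞ X U) {x : Plane} (hx : x ∈ U) (hX0 : X x ≠ 0) :
    ∃ (v : Plane → ℝ) (W : Set Plane), IsOpen W ∧ x ∈ W ∧ W ⊆ U ∧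
      ContDiffOn ℝ ∞ v W ∧ fderiv ℝ v x ≠ 0 ∧ ∀ p ∈ W, fderiv ℝ v p (X p) = 0 := by
  -- Some coordinate of `X x` is nonzero; swap the axes if it is the second.
  obtain ⟨L, hL⟩ : ∃ L : Plane ≃L[ℝ] ℝ × ℝ, (L (X x)).1 ≠ 0 := by
    let L₀ : Plane ≃L[ℝ] ℝ × ℝ :=
      (EuclideanSpace.equiv (Fin 2) ℝ).trans (ContinuousLinearEquiv.finTwoArrow ℝ ℝ)
    by_contra! h
    have h1 := h L₀
    have h2 := h (L₀.trans (ContinuousLinearEquiv.prodComm ℝ ℝ ℝ))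
    refine hX0 (L₀.injective ?_)
    rw [map_zero]
    exact Prod.ext h1 h2
  let T : Plane → ℝ × ℝ := fun p => L (p - x)
  let S : ℝ × ℝ → Plane := fun z => x + L.symm z
  have hST : ∀ p, S (T p) = p := fun p => by simp [S, T]
  have hS : ContDiff ℝ ∞ S := contDiff_const.add L.symm.contDiff
  have hT : ContDiff ℝ ∞ T := L.contDiff.comp (contDiff_id.sub contDiff_const)
  have hTD : ∀ p, HasFDerivAt T (L : Plane →L[ℝ] ℝ × ℝ) p := fun p =>
    (((L : Plane →L[ℝ] ℝ × ℝ).hasFDerivAt (x := p - x)).comp p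
      ((hasFDerivAt_id p).sub_const x)).congr_fderiv (ContinuousLinearMap.comp_id _)
  have hTx : T x = 0 := by simp [T]
  have hLX : ContDiffOn ℝ ∞ (fun p => L (X p)) U := L.contDiff.comp_contDiffOn hX
  let U₁ : Set Plane := U ∩ (fun p => (L (X p)).1) ⁻¹' {0}ᶜ
  have hU₁ : IsOpen U₁ :=
    (continuous_fst.comp_continuousOn hLX.continuousOn).isOpen_inter_preimage hU
      isOpen_compl_singleton
  let f₁ : Plane → ℝ := fun p => (L (X p)).2 / (L (X p)).1
  have hf₁ : ContDiffOn ℝ ∞ f₁ U₁ :=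
    (contDiff_snd.comp_contDiffOn (hLX.mono inter_subset_left)).div
      (contDiff_fst.comp_contDiffOn (hLX.mono inter_subset_left)) fun p hp => hp.2
  obtain ⟨v, W, hW, h0W, hWU, hv, hv0, hvX⟩ := exists_firstIntegral_graph
    (hU₁.preimage hS.continuous) (hf₁.comp hS.contDiffOn (mapsTo_preimage _ _))
    (show S 0 ∈ U₁ by simp only [S, map_zero, add_zero]; exact ⟨hx, hL⟩)
  have hd : ∀ p, T p ∈ W → HasFDerivAt (v ∘ T) ((fderiv ℝ v (T p)).comp
      (L : Plane →L[ℝ] ℝ × ℝ)) p := fun p hp =>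
    (((hv.contDiffAt (hW.mem_nhds hp)).differentiableAt (by simp)).hasFDerivAt).comp p (hTD p)
  refine ⟨v ∘ T, T ⁻¹' W, hW.preimage hT.continuous, by simpa [hTx] using h0W, fun p hp => ?_,
    hv.comp hT.contDiffOn (mapsTo_preimage _ _), fun h => hv0 ?_, fun p hp => ?_⟩
  · have : S (T p) ∈ U₁ := hWU hp
    rw [hST] at this
    exact this.1
  · rw [(hd x (by rwa [hTx])).fderiv, hTx] at h
    refine ContinuousLinearMap.ext fun z => ?_
    have := DFunLike.congr_fun h (L.symm z)
    simpa using this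
  · have h1 : S (T p) ∈ U₁ := hWU hp
    rw [hST] at h1
    have h2 := hvX _ hp
    rw [(hd p hp).fderiv]
    have h3 : L (X p) = (L (X p)).1 • ((1 : ℝ), f₁ p) := by
      have : (L (X p)).1 ≠ 0 := h1.2
      ext
      · simp
      · simp only [f₁, Prod.smul_snd, smul_eq_mul]; field_simp
    have h4 : (f₁ ∘ S) (T p) = f₁ p := by simp only [Function.comp_apply, hST]
    rw [h4] at h2
    simp only [ContinuousLinearMap.comp_apply, ContinuousLinearEquiv.coe_coe]
    rw [h3, map_smul, h2, smul_zero]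

/-- A first integral of `X` can be chosen increasing along a transverse field `Y`. -/
theorem exists_firstIntegral_pos {X Y : Plane → Plane} {U : Set Plane} (hU : IsOpen U)
    (hX : ContDiffOn ℝ ∞ X U) (hY : ContDiffOn ℝ ∞ Y U) {x : Plane} (hx : x ∈ U)
    (hXY : LinearIndependent ℝ ![X x, Y x]) :
    ∃ (v : Plane → ℝ) (W : Set Plane), IsOpen W ∧ x ∈ W ∧ W ⊆ U ∧
      ContDiffOn ℝ ∞ v W ∧ ∀ p ∈ W, fderiv ℝ v p (X p) = 0 ∧ 0 < fderiv ℝ v p (Y p) := by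
  obtain ⟨v, W, hW, hxW, hWU, hv, hv0, hvX⟩ := exists_firstIntegral hU hX hx (hXY.ne_zero 0)
  have hspan := hXY.span_eq_top_of_card_eq_finrank (by simp)
  have hne : fderiv ℝ v x (Y x) ≠ 0 := fun h => hv0 <| by
    refine ContinuousLinearMap.coe_injective (LinearMap.ext_on hspan ?_)
    rintro _ ⟨i, rfl⟩
    fin_cases i
    · simpa using hvX x hxW
    · simpa using h
  -- Scaling by the derivative's own value turns it into a positive square.
  obtain ⟨σ, hσ⟩ : ∃ σ : ℝ, 0 < σ * fderiv ℝ v x (Y x) :=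
    ⟨fderiv ℝ v x (Y x), mul_self_pos.2 hne⟩
  have hc : ContinuousOn (fun p => σ * fderiv ℝ v p (Y p)) W :=
    continuousOn_const.mul ((hv.continuousOn_fderiv_of_isOpen hW (by simp)).clm_apply
      (hY.continuousOn.mono hWU))
  refine ⟨fun p => σ * v p, W ∩ (fun p => σ * fderiv ℝ v p (Y p)) ⁻¹' Ioi 0,
    hc.isOpen_inter_preimage hW isOpen_Ioi, ⟨hxW, hσ⟩, fun p hp => hWU hp.1,
    contDiffOn_const.mul (hv.mono inter_subset_left), fun p hp => ?_⟩
  have hd : DifferentiableAt ℝ v p :=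
    (hv.contDiffAt (hW.mem_nhds hp.1)).differentiableAt (by simp)
  rw [fderiv_const_mul hd]
  refine ⟨?_, by simpa using hp.2⟩
  simp [hvX p hp.1]

/-- Planar coordinates whose coordinate fields are positive multiples of two given independent
fields. -/
theorem exists_planar_coordinates {X Y : Plane → Plane} {U : Set Plane} (hU : IsOpen U)
    (hX : ContDiffOn ℝ ∞ X U) (hY : ContDiffOn ℝ ∞ Y U) {x : Plane} (hx : x ∈ U)
    (hXY : LinearIndependent ℝ ![X x, Y x]) :
    ∃ (φ : OpenPartialHomeomorph Plane Plane) (lam mu : Plane → ℝ),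
      x ∈ φ.source ∧ φ.source ⊆ U ∧
      ContDiffOn ℝ ∞ φ φ.source ∧ ContDiffOn ℝ ∞ φ.symm φ.target ∧
      ContDiffOn ℝ ∞ lam φ.source ∧ ContDiffOn ℝ ∞ mu φ.source ∧
      ∀ p ∈ φ.source, 0 < lam p ∧ 0 < mu p ∧
        fderiv ℝ φ.symm (φ p) (EuclideanSpace.single 0 1) = lam p • X p ∧
        fderiv ℝ φ.symm (φ p) (EuclideanSpace.single 1 1) = mu p • Y p := by
  have hYX : LinearIndependent ℝ ![Y x, X x] := LinearIndependent.pair_symm_iff.1 hXY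
  obtain ⟨v, W₁, hW₁, hxW₁, hWU₁, hv, hvX⟩ := exists_firstIntegral_pos hU hX hY hx hXY
  obtain ⟨u, W₂, hW₂, hxW₂, hWU₂, hu, huY⟩ := exists_firstIntegral_pos hU hY hX hx hYX
  let W := W₁ ∩ W₂
  have hW : IsOpen W := hW₁.inter hW₂
  have hv' : ContDiffOn ℝ ∞ v W := hv.mono inter_subset_left
  have hu' : ContDiffOn ℝ ∞ u W := hu.mono inter_subset_right
  let F : Plane → Plane := fun p => !₂[u p, v p]
  have hF : ContDiffOn ℝ ∞ F W := by
    rw [contDiffOn_euclidean]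
    intro i
    fin_cases i
    · exact hu'
    · exact hv'
  have hFd : ∀ p ∈ W, HasFDerivAt F (fderiv ℝ F p) p := fun p hp =>
    ((hF.contDiffAt (hW.mem_nhds hp)).differentiableAt (by simp)).hasFDerivAt
  have hFu : ∀ p ∈ W, ∀ w, (fderiv ℝ F p w) 0 = fderiv ℝ u p w := fun p hp w => by
    have : fderiv ℝ u p = _ :=
      ((EuclideanSpace.proj (0 : Fin 2) : Plane →L[ℝ] ℝ).hasFDerivAt.comp p (hFd p hp)).fderiv
    exact (DFunLike.congr_fun this w).symm
  have hFv : ∀ p ∈ W, ∀ w, (fderiv ℝ F p w) 1 = fderiv ℝ v p w := fun p hp w => by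
    have : fderiv ℝ v p = _ :=
      ((EuclideanSpace.proj (1 : Fin 2) : Plane →L[ℝ] ℝ).hasFDerivAt.comp p (hFd p hp)).fderiv
    exact (DFunLike.congr_fun this w).symm
  have hFX : ∀ p ∈ W, fderiv ℝ F p (X p) =
      fderiv ℝ u p (X p) • EuclideanSpace.single 0 1 := fun p hp => by
    ext i
    fin_cases i
    · simpa using hFu p hp (X p)
    · simpa [(hvX p hp.1).1] using hFv p hp (X p)
  have hFY : ∀ p ∈ W, fderiv ℝ F p (Y p) =
      fderiv ℝ v p (Y p) • EuclideanSpace.single 1 1 := fun p hp => by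
    ext i
    fin_cases i
    · simpa [(huY p hp.2).1] using hFu p hp (Y p)
    · simpa using hFv p hp (Y p)
  have hxW : x ∈ W := ⟨hxW₁, hxW₂⟩
  have hinj : Function.Injective (fderiv ℝ F x : Plane →ₗ[ℝ] Plane) := by
    rw [← LinearMap.ker_eq_bot, LinearMap.ker_eq_bot']
    intro w hw
    have hspan := hXY.span_eq_top_of_card_eq_finrank (by simp)
    have hwm : w ∈ Submodule.span ℝ (range ![X x, Y x]) := by rw [hspan]; trivial
    rw [Matrix.range_cons, Matrix.range_cons, Matrix.range_empty, union_empty,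
      singleton_union, Submodule.mem_span_pair] at hwm
    obtain ⟨a, b, rfl⟩ := hwm
    have hu0 := hFu x hxW (a • X x + b • Y x)
    have hv0 := hFv x hxW (a • X x + b • Y x)
    have hw' : fderiv ℝ F x (a • X x + b • Y x) = 0 := hw
    rw [hw'] at hu0 hv0
    have ha : a = 0 := by simpa [(huY x hxW₂).1, (huY x hxW₂).2.ne'] using hu0.symm
    have hb : b = 0 := by simpa [(hvX x hxW₁).1, (hvX x hxW₁).2.ne'] using hv0.symm
    simp [ha, hb]
  let e : Plane ≃L[ℝ] Plane :=
    (LinearEquiv.ofInjectiveEndo (fderiv ℝ F x : Plane →ₗ[ℝ] Plane) hinj).toContinuousLinearEquiv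
  have he : HasFDerivAt F (e : Plane →L[ℝ] Plane) x := by
    convert hFd x hxW using 1
    ext1 w
    rfl
  obtain ⟨φ, hxφ, hφW, hφF, hφ, hφs⟩ := exists_openPartialHomeomorph_of_contDiffOn hW hF hxW e he
  have hsymm : ∀ p ∈ φ.source, ∀ w, fderiv ℝ φ.symm (φ p) (fderiv ℝ F p w) = w := fun p hp w => by
    have h1 : HasFDerivAt φ.symm (fderiv ℝ φ.symm (φ p)) (φ p) :=
      ((hφs.contDiffAt (φ.open_target.mem_nhds (φ.map_source hp))).differentiableAt
        (by simp)).hasFDerivAt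
    have h2 : HasFDerivAt φ (fderiv ℝ F p) p := by rw [hφF]; exact hFd p (hφW hp)
    have h3 := (h1.comp p h2).unique ((hasFDerivAt_id p).congr_of_eventuallyEq
      (f₁ := φ.symm ∘ φ) (by
        filter_upwards [φ.open_source.mem_nhds hp] with q hq using φ.left_inv hq))
    exact DFunLike.congr_fun h3 w
  have hsm : ∀ {w : Plane → ℝ} {Z : Plane → Plane}, ContDiffOn ℝ ∞ w W → ContDiffOn ℝ ∞ Z U →
      (∀ p ∈ W, 0 < fderiv ℝ w p (Z p)) →
      ContDiffOn ℝ ∞ (fun p => (fderiv ℝ w p (Z p))⁻¹) φ.source := fun hw hZ hpos =>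
    (((hw.fderiv_of_isOpen hW (m := ∞) le_rfl).clm_apply
      (hZ.mono fun p hp => hWU₁ hp.1)).inv fun p hp => (hpos p hp).ne').mono hφW
  refine ⟨φ, fun p => (fderiv ℝ u p (X p))⁻¹, fun p => (fderiv ℝ v p (Y p))⁻¹, hxφ,
    fun p hp => hWU₁ (hφW hp).1, hφ, hφs, hsm hu' hX fun p hp => (huY p hp.2).2,
    hsm hv' hY fun p hp => (hvX p hp.1).2, fun p hp => ?_⟩
  have hpW := hφW hp
  have hpu := (huY p hpW.2).2
  have hpv := (hvX p hpW.1).2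
  refine ⟨inv_pos.2 hpu, inv_pos.2 hpv, ?_, ?_⟩
  · rw [eq_inv_smul_iff₀ hpu.ne', ← map_smul, ← hFX p hpW, hsymm p hp]
  · rw [eq_inv_smul_iff₀ hpv.ne', ← map_smul, ← hFY p hpW, hsymm p hp]

end Planar

/-! ### Transfer of adapted coordinates to the surface through a chart. -/

section Surface

variable {M : Type*} [TopologicalSpace M] [ChartedSpace Plane M] [IsManifold (𝓡 2) ∞ M]

instance : IsManifold (𝓡 2) 1 M := IsManifold.of_le (n := ∞) (by simp)

/-- Lets coordinate fields, defined by derivatives of inverse charts, be compared with `chartField`,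
defined by the trivialization. -/
theorem mfderiv_chartAt_symm {p q : M} (hq : q ∈ (chartAt Plane p).source) :
    mfderiv (𝓡 2) (𝓡 2) (chartAt Plane p).symm (chartAt Plane p q) =
      (trivializationAt Plane (TangentSpace (𝓡 2)) p).symmL ℝ q := by
  rw [TangentBundle.symmL_trivializationAt hq]
  simp only [mfld_simps, mfderivWithin_univ]

/-- The expression of a vector field in the preferred chart at `p`. -/
noncomputable def chartField (p : M) (X : (q : M) → TangentSpace (𝓡 2) q) (z : Plane) : Plane :=
  (trivializationAt Plane (TangentSpace (𝓡 2)) p).continuousLinearMapAt ℝ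
    ((chartAt Plane p).symm z) (X ((chartAt Plane p).symm z))

theorem contDiffOn_chartField {p : M} {X : (q : M) → TangentSpace (𝓡 2) q} {U : Set M}
    (hU : IsOpen U) (hUc : U ⊆ (chartAt Plane p).source) (hX : SmoothFieldOn X U) :
    ContDiffOn ℝ ∞ (chartField p X)
      ((chartAt Plane p).target ∩ (chartAt Plane p).symm ⁻¹' U) := by
  rw [← contMDiffOn_iff_contDiffOn]
  have h1 := ((trivializationAt Plane (TangentSpace (𝓡 2)) p).contMDiffOn_section_iff
    (n := ∞) (IB := 𝓡 2) (s := X) hU hUc).1 hX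
  have h2 : ContMDiffOn (𝓡 2) (𝓡 2) ∞ (chartAt Plane p).symm (chartAt Plane p).target :=
    contMDiffOn_chart_symm
  refine (h1.comp (h2.mono inter_subset_left) fun z hz => hz.2).congr fun z hz => ?_
  simp only [chartField, Function.comp_apply, Bundle.Trivialization.continuousLinearMapAt_apply]
  rw [Bundle.Trivialization.coe_linearMapAt_of_mem _ (hUc hz.2)]

theorem symmL_chartField {p q : M} (hq : q ∈ (chartAt Plane p).source)
    (X : (q : M) → TangentSpace (𝓡 2) q) :
    (trivializationAt Plane (TangentSpace (𝓡 2)) p).symmL ℝ q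
      (chartField p X (chartAt Plane p q)) = X q := by
  unfold chartField
  rw [(chartAt Plane p).left_inv hq]
  exact Bundle.Trivialization.symmL_continuousLinearMapAt _ hq _

theorem linearIndependent_chartField {p q : M} (hq : q ∈ (chartAt Plane p).source)
    {X Y : (q : M) → TangentSpace (𝓡 2) q} (hXY : LinearIndependent ℝ ![X q, Y q]) :
    LinearIndependent ℝ ![chartField p X (chartAt Plane p q),
      chartField p Y (chartAt Plane p q)] := by
  rw [LinearIndependent.pair_iff] at hXY ⊢
  intro s t hst
  refine hXY s t ?_
  have := congrArg ((trivializationAt Plane (TangentSpace (𝓡 2)) p).symmL ℝ q) hst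
  rwa [map_add, map_smul, map_smul, symmL_chartField hq, symmL_chartField hq, map_zero] at this

/-- Coordinates on a surface whose coordinate fields are positive multiples of two given smooth
fields, independent at a point. -/
theorem exists_coordinates_adapted {p : M} {U : Set M} (hU : U ∈ 𝓝 p)
    {X Y : (q : M) → TangentSpace (𝓡 2) q} (hX : SmoothFieldOn X U) (hY : SmoothFieldOn Y U)
    (hXY : LinearIndependent ℝ ![X p, Y p]) :
    ∃ φ ∈ IsManifold.maximalAtlas (𝓡 2) ∞ M, p ∈ φ.source ∧ φ.source ⊆ U ∧
      ∃ lam mu : M → ℝ,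
        ContMDiffOn (𝓡 2) 𝓘(ℝ, ℝ) ∞ lam φ.source ∧
        ContMDiffOn (𝓡 2) 𝓘(ℝ, ℝ) ∞ mu φ.source ∧
        ∀ q ∈ φ.source, 0 < lam q ∧ 0 < mu q ∧
          coordField φ 0 q = lam q • X q ∧ coordField φ 1 q = mu q • Y q := by
  let c := chartAt Plane p
  have hpc : p ∈ c.source := mem_chart_source Plane p
  let U' := interior U ∩ c.source
  have hU' : IsOpen U' := isOpen_interior.inter c.open_source
  have hU'U : U' ⊆ U := fun q hq => interior_subset hq.1
  have hpU' : p ∈ U' := ⟨mem_interior_iff_mem_nhds.2 hU, hpc⟩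
  obtain ⟨φ, lam, mu, hpφ, hφU, hφ, hφs, hlam, hmu, hc⟩ := exists_planar_coordinates
    (c.isOpen_inter_preimage_symm hU')
    (contDiffOn_chartField hU' inter_subset_right (hX.mono hU'U))
    (contDiffOn_chartField hU' inter_subset_right (hY.mono hU'U))
    (x := c p) ⟨c.map_source hpc, by simpa [c.left_inv hpc] using hpU'⟩
    (linearIndependent_chartField hpc hXY)
  have hcs : ContMDiffOn (𝓡 2) (𝓡 2) ∞ c c.source := contMDiffOn_chart
  have hct : ContMDiffOn (𝓡 2) (𝓡 2) ∞ c.symm c.target := contMDiffOn_chart_symm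
  have hsrc : ∀ q ∈ (c.trans φ).source, q ∈ c.source ∧ c q ∈ φ.source := fun q hq => by
    simpa using hq
  refine ⟨c.trans φ, ?_, by simpa using ⟨hpc, hpφ⟩, fun q hq => ?_, lam ∘ c, mu ∘ c, ?_, ?_,
    fun q hq => ?_⟩
  · refine OpenPartialHomeomorph.mem_maximalAtlas_of_contMDiffOn _ ?_ ?_
    · rw [OpenPartialHomeomorph.coe_trans]
      exact hφ.contMDiffOn.comp (hcs.mono fun q hq => (hsrc q hq).1) fun q hq => (hsrc q hq).2
    · rw [OpenPartialHomeomorph.coe_trans_symm]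
      rw [OpenPartialHomeomorph.trans_target]
      exact hct.comp (hφs.contMDiffOn.mono inter_subset_left) fun q hq => hq.2
  · have := (hφU (hsrc q hq).2).2
    rw [mem_preimage, c.left_inv (hsrc q hq).1] at this
    exact hU'U this
  · exact hlam.contMDiffOn.comp (hcs.mono fun q hq => (hsrc q hq).1) fun q hq => (hsrc q hq).2
  · exact hmu.contMDiffOn.comp (hcs.mono fun q hq => (hsrc q hq).1) fun q hq => (hsrc q hq).2
  · obtain ⟨hqc, hqφ⟩ := hsrc q hq
    obtain ⟨h1, h2, h3, h4⟩ := hc _ hqφ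
    -- Chain rule: coordinate fields of the composite chart are the planar ones pushed forward by
    -- `c.symm`.
    have hcomp : ∀ w : Plane, mfderiv (𝓡 2) (𝓡 2) (c.trans φ).symm ((c.trans φ) q) w =
        (trivializationAt Plane (TangentSpace (𝓡 2)) p).symmL ℝ q
          (fderiv ℝ φ.symm (φ (c q)) w) := fun w => by
      have hd1 : MDifferentiableAt (𝓡 2) (𝓡 2) φ.symm (φ (c q)) :=
        ((hφs.contDiffAt (φ.open_target.mem_nhds (φ.map_source hqφ))).differentiableAt
          (by simp)).mdifferentiableAt
      have hd2 : MDifferentiableAt (𝓡 2) (𝓡 2) c.symm (φ.symm (φ (c q))) := by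
        rw [φ.left_inv hqφ]
        exact (hct.contMDiffAt (c.open_target.mem_nhds (c.map_source hqc))).mdifferentiableAt
          (by simp)
      have hchain := DFunLike.congr_fun (mfderiv_comp (φ (c q)) hd2 hd1) w
      have hsymm : ∀ z, z = c q → ∀ w : Plane,
          (mfderiv (𝓡 2) (𝓡 2) c.symm z : Plane →L[ℝ] Plane) w =
            ((trivializationAt Plane (TangentSpace (𝓡 2)) p).symmL ℝ q : Plane →L[ℝ] Plane) w := by
        rintro z rfl w
        exact DFunLike.congr_fun (mfderiv_chartAt_symm hqc) w
      refine hchain.trans ((hsymm _ (φ.left_inv hqφ) _).trans ?_)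
      rw [mfderiv_eq_fderiv]
      rfl
    refine ⟨h1, h2, ?_, ?_⟩
    · unfold coordField
      rw [hcomp, h3, map_smul, symmL_chartField hqc]
      rfl
    · unfold coordField
      rw [hcomp, h4, map_smul, symmL_chartField hqc]
      rfl

end Surface

/-! ### Signs on an orthogonal basis of a Lorentz plane. -/

section LinearAlgebra

variable {V : Type*} [AddCommGroup V] [Module ℝ V] [TopologicalSpace V]
    [IsTopologicalAddGroup V] [ContinuousConstSMul ℝ V] [FiniteDimensional ℝ V]
    {b : V →L[ℝ] V →L[ℝ] ℝ}

omit [FiniteDimensional ℝ V] in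
theorem quadForm_apply (v : V) : quadForm b v = b v v := rfl

theorem exists_apply_self_neg (hb : sigNeg (quadForm b) = 1) : ∃ v, b v v < 0 := by
  obtain ⟨W, hW, hpos⟩ := exists_finrank_eq_sigNeg_and_negDef (Q := quadForm b)
  rw [hb] at hW
  have : Nontrivial W := Module.nontrivial_of_finrank_pos (R := ℝ) (by omega)
  obtain ⟨w, hw⟩ := exists_ne (0 : W)
  have := hpos w hw
  exact ⟨w, by simpa [quadForm_apply] using this⟩

/-- A nondegenerate form of index one on a plane takes values of opposite signs on the vectors of
an orthogonal basis. -/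
theorem apply_self_mul_apply_self_neg (hV : Module.finrank ℝ V = 2)
    (hsymm : ∀ v w, b v w = b w v) (hnd : ∀ v, (∀ w, b v w = 0) → v = 0)
    (hb : sigNeg (quadForm b) = 1) {x y : V} (hxy : b x y = 0)
    (hspan : ∀ v, ∃ s t : ℝ, v = s • x + t • y) : b x x * b y y < 0 := by
  have hform : ∀ s t : ℝ, b (s • x + t • y) (s • x + t • y) = s ^ 2 * b x x + t ^ 2 * b y y :=
    fun s t => by
      have hyx : b y x = 0 := by rw [hsymm, hxy]
      simp [hxy, hyx]; ring
  -- A null `x` would be orthogonal to everything, hence zero, and `y` alone would span the plane.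
  have hne : ∀ {x y : V}, b x y = 0 → (∀ v, ∃ s t : ℝ, v = s • x + t • y) → b x x ≠ 0 :=
    fun {x y} hxy hspan h0 => by
      have hx : x = 0 := hnd x fun w => by
        obtain ⟨s, t, rfl⟩ := hspan w
        simp [h0, hxy]
      have := finrank_le_one (R := ℝ) y fun w => by
        obtain ⟨s, t, rfl⟩ := hspan w
        exact ⟨t, by simp [hx]⟩
      omega
  have hx : b x x ≠ 0 := hne hxy hspan
  have hy : b y y ≠ 0 := hne (by rw [hsymm, hxy]) fun v => by
    obtain ⟨s, t, h⟩ := hspan v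
    exact ⟨t, s, by rw [h, add_comm]⟩
  rcases hx.lt_or_gt with hx | hx <;> rcases hy.lt_or_gt with hy | hy
  -- Two negative values would make the whole plane negative definite, so the index would be at
  -- least `2`.
  · have h2 : Module.finrank ℝ (⊤ : Submodule ℝ V) ≤ sigNeg (quadForm b) := by
      refine le_sigNeg_of_negDef _ fun v hv => ?_
      obtain ⟨s, t, h⟩ := hspan v
      have hst : s ≠ 0 ∨ t ≠ 0 := by
        by_contra! h'
        exact hv (Subtype.ext (by rw [h, h'.1, h'.2]; simp))
      have hval : b (v : V) (v : V) < 0 := by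
        rw [h, hform]
        rcases hst with hs | ht
        · nlinarith [sq_pos_of_ne_zero hs, sq_nonneg t, mul_pos (sq_pos_of_ne_zero hs) (neg_pos.2 hx),
            mul_nonneg (sq_nonneg t) (neg_pos.2 hy).le]
        · nlinarith [mul_pos (sq_pos_of_ne_zero ht) (neg_pos.2 hy),
            mul_nonneg (sq_nonneg s) (neg_pos.2 hx).le]
      simpa [quadForm_apply] using hval
    rw [finrank_top] at h2
    omega
  · exact mul_neg_of_neg_of_pos hx hy
  · exact mul_neg_of_pos_of_neg hx hy
  -- Two positive values would leave no negative vector, contrary to index one.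
  · obtain ⟨v, hv⟩ := exists_apply_self_neg hb
    obtain ⟨s, t, rfl⟩ := hspan v
    rw [hform] at hv
    exact absurd hv (not_lt.2 (by positivity))

end LinearAlgebra

/-! ### Orthogonal frames and orthogonal coordinates on a Lorentz surface. -/

section Surface

variable {M : Type*} [TopologicalSpace M] [ChartedSpace Plane M] [IsManifold (𝓡 2) ∞ M]

omit [IsManifold (𝓡 2) ∞ M] in
/-- A tangent vector is the combination of the coordinate fields with the coordinate forms as
coefficients. -/
theorem eq_coordForm_smul_coordField {φ : OpenPartialHomeomorph M Plane}
    (hφ : φ ∈ IsManifold.maximalAtlas (𝓡 2) ∞ M) {q : M} (hq : q ∈ φ.source)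
    (v : TangentSpace (𝓡 2) q) :
    v = coordForm φ 0 q v • coordField φ 0 q + coordForm φ 1 q v • coordField φ 1 q := by
  have hd : MDifferentiableAt (𝓡 2) (𝓡 2) φ q :=
    (contMDiffAt_of_mem_maximalAtlas hφ hq).mdifferentiableAt (by simp)
  have hds : MDifferentiableAt (𝓡 2) (𝓡 2) φ.symm (φ q) :=
    (contMDiffAt_symm_of_mem_maximalAtlas hφ (φ.map_source hq)).mdifferentiableAt (by simp)
  let A : Plane →L[ℝ] Plane := mfderiv (𝓡 2) (𝓡 2) φ q
  let B : Plane →L[ℝ] Plane := mfderiv (𝓡 2) (𝓡 2) φ.symm (φ q)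
  have hform : ∀ i, coordForm φ i q v = (A v) i := fun i => by
    have hproj : HasMFDerivAt (𝓡 2) 𝓘(ℝ, ℝ)
        (EuclideanSpace.proj i : Plane →L[ℝ] ℝ) (φ q) (EuclideanSpace.proj i : Plane →L[ℝ] ℝ) :=
      (EuclideanSpace.proj i : Plane →L[ℝ] ℝ).hasMFDerivAt
    exact DFunLike.congr_fun (hproj.comp q hd.hasMFDerivAt).mfderiv v
  -- Differentiate `φ.symm ∘ φ = id` near `q`.
  have hBA : B (A v) = v := by
    have h1 := (hds.hasMFDerivAt.comp q hd.hasMFDerivAt).congr_of_eventuallyEq (f₁ := id) (by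
      filter_upwards [φ.open_source.mem_nhds hq] with z hz using (φ.left_inv hz).symm)
    have h2 := hasMFDerivAt_unique h1 (hasMFDerivAt_id q)
    exact DFunLike.congr_fun h2 v
  have hA : A v = (A v) 0 • EuclideanSpace.single 0 1 + (A v) 1 • EuclideanSpace.single 1 1 := by
    ext i
    fin_cases i <;> simp
  have hB := congrArg B hA
  rw [hBA, map_add, map_smul, map_smul, ← hform, ← hform] at hB
  exact hB

/-- The local vector field that is constant in the preferred chart at `p`. -/
noncomputable def constField (p : M) (w : Plane) (q : M) : TangentSpace (𝓡 2) q :=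
  (trivializationAt Plane (TangentSpace (𝓡 2)) p).symmL ℝ q w

theorem smoothFieldOn_constField (p : M) (w : Plane) :
    SmoothFieldOn (constField p w) (chartAt Plane p).source := by
  refine ((trivializationAt Plane (TangentSpace (𝓡 2)) p).contMDiffOn_section_iff
    (n := ∞) (IB := 𝓡 2) (s := constField p w) (chartAt Plane p).open_source subset_rfl).2 ?_
  refine (contMDiffOn_const (c := w)).congr fun q hq => ?_
  have := (trivializationAt Plane (TangentSpace (𝓡 2)) p).continuousLinearMapAt_symmL (R := ℝ) hq w
  rwa [Bundle.Trivialization.continuousLinearMapAt_apply,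
    Bundle.Trivialization.coe_linearMapAt_of_mem _ hq] at this

theorem LorentzMetric.contMDiffOn_inner (g : LorentzMetric M) {U : Set M}
    {X Y : (q : M) → TangentSpace (𝓡 2) q} (hX : SmoothFieldOn X U) (hY : SmoothFieldOn Y U) :
    ContMDiffOn (𝓡 2) 𝓘(ℝ, ℝ) ∞ (fun q => g.inner q (X q) (Y q)) U := by
  have h : ContMDiffOn (𝓡 2) ((𝓡 2).prod 𝓘(ℝ, ℝ)) ∞
      (fun q => Bundle.TotalSpace.mk' ℝ (E := Bundle.Trivial M ℝ) q (g.inner q (X q) (Y q))) U :=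
    ContMDiffOn.clm_bundle_apply₂ (E₁ := fun q : M => TangentSpace (𝓡 2) q)
      (E₂ := fun q : M => TangentSpace (𝓡 2) q) (F₁ := Plane) (F₂ := Plane)
      g.contMDiff.contMDiffOn hX hY
  exact fun q hq => (Bundle.contMDiffWithinAt_totalSpace.1 (h q hq)).2

/-- Near every point there is a smooth orthogonal frame. -/
theorem exists_orthogonal_frame (g : LorentzMetric M) (p : M) :
    ∃ U ∈ 𝓝 p, ∃ X Y : (q : M) → TangentSpace (𝓡 2) q,
      SmoothFieldOn X U ∧ SmoothFieldOn Y U ∧ LinearIndependent ℝ ![X p, Y p] ∧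
      ∀ q ∈ U, g.inner q (X q) (Y q) = 0 := by
  have hpc : p ∈ (chartAt Plane p).source := mem_chart_source Plane p
  let e := trivializationAt Plane (TangentSpace (𝓡 2)) p
  obtain ⟨x, hx⟩ : ∃ x : TangentSpace (𝓡 2) p, g.inner p x x < 0 :=
    have : FiniteDimensional ℝ (TangentSpace (𝓡 2) p) := inferInstanceAs (FiniteDimensional ℝ Plane)
    exists_apply_self_neg (g.index_eq_one p)
  let w₀ : Plane := e.continuousLinearMapAt ℝ p x
  have hXp : constField p w₀ p = x := e.symmL_continuousLinearMapAt hpc x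
  have hw₀ : w₀ ≠ 0 := fun h => by
    have : x = 0 := by rw [← hXp, h]; exact map_zero _
    rw [this] at hx
    simp at hx
  obtain ⟨w₁, hw⟩ := exists_linearIndependent_pair_of_one_lt_finrank (R := ℝ) (M := Plane)
    (by simp) hw₀
  let X := constField p w₀
  let Z := constField p w₁
  have hX : SmoothFieldOn X _ := smoothFieldOn_constField p w₀
  have hZ : SmoothFieldOn Z _ := smoothFieldOn_constField p w₁
  have hXX := g.contMDiffOn_inner hX hX
  have hXZ := g.contMDiffOn_inner hX hZ
  let U : Set M := (chartAt Plane p).source ∩ (fun q => g.inner q (X q) (X q)) ⁻¹' {0}ᶜ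
  have hU : IsOpen U :=
    hXX.continuousOn.isOpen_inter_preimage (chartAt Plane p).open_source isOpen_compl_singleton
  have hpU : p ∈ U := ⟨hpc, by
    change g.inner p (X p) (X p) ≠ 0
    rw [show X p = x from hXp]
    exact hx.ne⟩
  let a : M → ℝ := fun q => g.inner q (X q) (Z q) / g.inner q (X q) (X q)
  have ha : ContMDiffOn (𝓡 2) 𝓘(ℝ, ℝ) ∞ a U :=
    (hXZ.mono inter_subset_left).div₀ (hXX.mono inter_subset_left) fun q hq => hq.2
  -- Gram–Schmidt: `a` is the projection coefficient of `Z` on `X`, smooth because `X` is non-null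
  -- on `U`.
  refine ⟨U, hU.mem_nhds hpU, X, fun q => Z q - a q • X q, hX.mono inter_subset_left, ?_, ?_,
    fun q hq => ?_⟩
  · exact ContMDiffOn.sub_section (hZ.mono inter_subset_left)
      (ContMDiffOn.smul_section ha (hX.mono inter_subset_left))
  · rw [LinearIndependent.pair_iff] at hw ⊢
    intro s t hst
    have h1 : (s - t * a p) • X p + t • Z p = 0 := by
      rw [← hst]; module
    have h2 : e.symmL ℝ p ((s - t * a p) • w₀ + t • w₁) = 0 := by
      rw [map_add, map_smul, map_smul]; exact h1
    have h3 := congrArg (e.continuousLinearMapAt ℝ p) h2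
    rw [e.continuousLinearMapAt_symmL hpc, map_zero] at h3
    obtain ⟨h4, h5⟩ := hw _ _ h3
    simp only [h5, zero_mul, sub_zero] at h4
    exact ⟨h4, h5⟩
  · have : g.inner q (X q) (X q) ≠ 0 := hq.2
    simp only [map_sub, map_smul, smul_eq_mul, a]
    field_simp
    ring

/-- Every point of a Lorentz surface has orthogonal coordinates. -/
theorem exists_orthogonal_coordinates (g : LorentzMetric M) (p : M) :
    ∃ φ ∈ IsManifold.maximalAtlas (𝓡 2) ∞ M, p ∈ φ.source ∧
      ∃ E G : M → ℝ,
        ContMDiffOn (𝓡 2) 𝓘(ℝ, ℝ) ∞ E φ.source ∧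
        ContMDiffOn (𝓡 2) 𝓘(ℝ, ℝ) ∞ G φ.source ∧
        ∀ q ∈ φ.source,
          E q = metricCoeff g φ 0 0 q ∧
          metricCoeff g φ 0 1 q = 0 ∧
          G q = metricCoeff g φ 1 1 q ∧
          E q * G q < 0 ∧
          ∀ v w : TangentSpace (𝓡 2) q,
            g.inner q v w =
              E q * (coordForm φ 0 q v * coordForm φ 0 q w) +
              G q * (coordForm φ 1 q v * coordForm φ 1 q w) := by
  obtain ⟨U, hU, X, Y, hX, hY, hXY, horth⟩ := exists_orthogonal_frame g p
  obtain ⟨φ, hφ, hpφ, hφU, lam, mu, hlam, hmu, h⟩ := exists_coordinates_adapted hU hX hY hXY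
  have hE : ContMDiffOn (𝓡 2) 𝓘(ℝ, ℝ) ∞ (metricCoeff g φ 0 0) φ.source := by
    refine ((hlam.mul hlam).mul (g.contMDiffOn_inner (hX.mono hφU) (hX.mono hφU))).congr
      fun q hq => ?_
    simp only [metricCoeff, (h q hq).2.2.1, map_smul, _root_.smul_apply, smul_eq_mul,
      Pi.mul_apply]
    ring
  have hG : ContMDiffOn (𝓡 2) 𝓘(ℝ, ℝ) ∞ (metricCoeff g φ 1 1) φ.source := by
    refine ((hmu.mul hmu).mul (g.contMDiffOn_inner (hY.mono hφU) (hY.mono hφU))).congr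
      fun q hq => ?_
    simp only [metricCoeff, (h q hq).2.2.2, map_smul, _root_.smul_apply, smul_eq_mul,
      Pi.mul_apply]
    ring
  refine ⟨φ, hφ, hpφ, metricCoeff g φ 0 0, metricCoeff g φ 1 1, hE, hG, fun q hq => ?_⟩
  have hF : metricCoeff g φ 0 1 q = 0 := by
    simp [metricCoeff, (h q hq).2.2.1, (h q hq).2.2.2, horth q (hφU hq)]
  have hdec := eq_coordForm_smul_coordField hφ hq
  refine ⟨rfl, hF, rfl, ?_, fun v w => ?_⟩
  · have : FiniteDimensional ℝ (TangentSpace (𝓡 2) q) := inferInstanceAs (FiniteDimensional ℝ Plane)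
    have hdim : Module.finrank ℝ (TangentSpace (𝓡 2) q) = 2 := finrank_euclideanSpace_fin
    exact apply_self_mul_apply_self_neg hdim (g.symm q) (g.nondegenerate q) (g.index_eq_one q)
      hF fun v => ⟨_, _, hdec v⟩
  · have hF' : g.inner q (coordField φ 1 q) (coordField φ 0 q) = 0 := by
      rw [g.symm]; exact hF
    have hF'' : g.inner q (coordField φ 0 q) (coordField φ 1 q) = 0 := hF
    conv_lhs => rw [hdec v, hdec w]
    simp only [map_add, map_smul, _root_.add_apply, _root_.smul_apply,
      smul_eq_mul, hF', hF'', metricCoeff]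
    ring

end Surface

end LorentzSurface

theorem mainTheorem6 {M : Type*} [TopologicalSpace M] [ChartedSpace LorentzSurface.Plane M]
    [IsManifold (𝓡 2) ∞ M] :
    (∀ (p : M) (U : Set M), U ∈ nhds p →
      ∀ X Y : (q : M) → TangentSpace (𝓡 2) q,
        LorentzSurface.SmoothFieldOn X U → LorentzSurface.SmoothFieldOn Y U →
        (∀ q ∈ U, LinearIndependent ℝ ![X q, Y q]) →
        ∃ φ ∈ IsManifold.maximalAtlas (𝓡 2) ∞ M, p ∈ φ.source ∧ φ.source ⊆ U ∧
          ∃ lam mu : M → ℝ,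
            ContMDiffOn (𝓡 2) 𝓘(ℝ, ℝ) ∞ lam φ.source ∧
            ContMDiffOn (𝓡 2) 𝓘(ℝ, ℝ) ∞ mu φ.source ∧
            ∀ q ∈ φ.source, 0 < lam q ∧ 0 < mu q ∧
              LorentzSurface.coordField φ 0 q = lam q • X q ∧
              LorentzSurface.coordField φ 1 q = mu q • Y q) ∧
    (∀ (g : LorentzSurface.LorentzMetric M) (p : M),
      ∃ φ ∈ IsManifold.maximalAtlas (𝓡 2) ∞ M, p ∈ φ.source ∧
        ∃ E G : M → ℝ,
          ContMDiffOn (𝓡 2) 𝓘(ℝ, ℝ) ∞ E φ.source ∧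
          ContMDiffOn (𝓡 2) 𝓘(ℝ, ℝ) ∞ G φ.source ∧
          ∀ q ∈ φ.source,
            E q = LorentzSurface.metricCoeff g φ 0 0 q ∧
            LorentzSurface.metricCoeff g φ 0 1 q = 0 ∧
            G q = LorentzSurface.metricCoeff g φ 1 1 q ∧
            E q * G q < 0 ∧
            ∀ v w : TangentSpace (𝓡 2) q,
              g.inner q v w =
                E q * (LorentzSurface.coordForm φ 0 q v * LorentzSurface.coordForm φ 0 q w) +
                G q * (LorentzSurface.coordForm φ 1 q v * LorentzSurface.coordForm φ 1 q w)) :=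
  ⟨fun _ _ hU _ _ hX hY hXY =>
    LorentzSurface.exists_coordinates_adapted hU hX hY (hXY _ (mem_of_mem_nhds hU)),
  fun g p => LorentzSurface.exists_orthogonal_coordinates g p⟩
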